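/- Let $q = 2^{2e+1}$ with $e \ge 1$, and let $F = \mathrm{GF}(q)$. Let $V$ be a $4$-dimensional vector space over $F$ and let $\kappa : V \to F$ be a non-singular quadratic form of minus type, i.e. no nonzero $x\in V$ satisfies both $\kappa(x)=0$ and $\kappa(x+y)=\kappa(x)+\kappa(y)$ for all $y \in V$, and the largest dimension of a subspace of $V$ on which $\kappa$ vanishes is $1$. The affine polar graph $\mathrm{VO}_4^-(q)$ has vertex set $V$, and two distinct vertices $u,v$ are joined if $\kappa(u-v)=0$. Let $\sigma(t)=t^{2^{e+1}}$ for $t \in F$, and let $$O=\{(0:0:1:0)\}\cup\{(x:y:z:1)\mid x,y,z\in F,\ z=xy+x^2x^\sigma+y^\sigma\}$$ be the Suzuki–Tits ovoid in the projective space of $F^4$. The Suzuki group $\mathrm{Sz}(q)$ is the group of all linear collineations of this projective space that preserve $O$; equivalently, as $q$ is even, the group of all matrices in $\mathrm{SL}_4(q)$ that preserve $O$. The Suzuki–Tits ovoid graph $\mathrm{VSz}(q)$ has vertex set $F^4$, and two distinct vertices $u,v$ are joined if the line through them has its direction in $O$, i.e. if $\langle u-v\rangle\in O$. Then no subgroup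 of $\mathrm{Aut}(\mathrm{VO}_4^-(q))$ is isomorphic to $\mathrm{Sz}(q)$. In particular, the graphs $\mathrm{VO}_4^-(q)$ and $\mathrm{VSz}(q)$ are not isomorphic. -/

import Mathlib

open scoped LinearAlgebra.Projectivization Pointwise MatrixGroups

/-- The submodule `W` is totally singular for the quadratic form `κ`: `κ` vanishes on `W`. -/
def IsTotallySingular {F V : Type*} [Field F] [AddCommGroup V] [Module F V]
    (κ : QuadraticForm F V) (W : Submodule F V) : Prop :=
  ∀ x ∈ W, κ x = 0

/-- `k` is the Witt index of `κ`: the largest dimension of a totally singular subspace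
(to be used for finite-dimensional `V`). -/
def HasWittIndex {F V : Type*} [Field F] [AddCommGroup V] [Module F V]
    (κ : QuadraticForm F V) (k : ℕ) : Prop :=
  (∃ W : Submodule F V, IsTotallySingular κ W ∧ Module.finrank F W = k) ∧
    ∀ W : Submodule F V, IsTotallySingular κ W → Module.finrank F W ≤ k

/-- `κ` is a non-singular quadratic form of minus type on a space of dimension `2m` (`m ≥ 1`):
its radical `{x | κ x = 0 and f(x, y) = 0 for all y}`, with `f` the polar form of `κ`, is zero,
and its Witt index `k` is `m - 1`. -/
def IsNonsingularOfMinusType {F V : Type*} [Field F] [AddCommGroup V] [Module F V]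
    (κ : QuadraticForm F V) (m : ℕ) : Prop :=
  Module.finrank F V = 2 * m ∧ κ.radical = ⊥ ∧ ∃ k : ℕ, k + 1 = m ∧ HasWittIndex κ k

/-- The graph with vertex set `V` in which distinct `u`, `v` are joined iff `κ (u - v) = 0`.
It is the affine polar graph `VO_{2m}^-(q)` when `κ` is a non-singular form of minus type on a
space of dimension `2m` over the field of order `q`. -/
def affinePolarGraph {F V : Type*} [Field F] [AddCommGroup V] [Module F V]
    (κ : QuadraticForm F V) : SimpleGraph V where
  Adj u v := u ≠ v ∧ κ (u - v) = 0
  symm := ⟨fun u v h => ⟨h.1.symm, by rw [← neg_sub, QuadraticMap.map_neg]; exact h.2⟩⟩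
  loopless := ⟨fun _ h => h.1 rfl⟩

/-- The Suzuki-Tits ovoid in the projective space of `F⁴`, where `F` is the field of order
`2 ^ (2 * e + 1)` and `σ(t) = t ^ (2 ^ (e + 1))`: the point `(0 : 0 : 1 : 0)` together with the
points `(x : y : z : 1)` such that `z = x y + x² x^σ + y^σ`. -/
def suzukiTitsOvoid (F : Type*) [Field F] (e : ℕ) : Set (ℙ F (Fin 4 → F)) :=
  {p | (∃ h : (![0, 0, 1, 0] : Fin 4 → F) ≠ 0, p = Projectivization.mk F ![0, 0, 1, 0] h) ∨
    ∃ (x y z : F) (h : (![x, y, z, 1] : Fin 4 → F) ≠ 0),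
      z = x * y + x ^ 2 * x ^ (2 ^ (e + 1)) + y ^ (2 ^ (e + 1)) ∧
        p = Projectivization.mk F ![x, y, z, 1] h}

/-- The Suzuki-Tits ovoid graph `VSz(q)`, `q = 2 ^ (2 * e + 1) = |F|`: the vertices are the vectors
of `F⁴`, and two distinct vectors are joined iff the line through them has its direction in the
Suzuki-Tits ovoid. -/
def suzukiTitsGraph (F : Type*) [Field F] (e : ℕ) : SimpleGraph (Fin 4 → F) where
  Adj u v := ∃ h : u - v ≠ 0, Projectivization.mk F (u - v) h ∈ suzukiTitsOvoid F e
  symm := ⟨by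
    rintro u v ⟨h, hm⟩
    have h' : v - u ≠ 0 := by rw [← neg_sub]; exact neg_ne_zero.mpr h
    refine ⟨h', ?_⟩
    have : Projectivization.mk F (v - u) h' = Projectivization.mk F (u - v) h := by
      rw [Projectivization.mk_eq_mk_iff']
      exact ⟨-1, by simp⟩
    rw [this]
    exact hm⟩
  loopless := ⟨fun u h => h.1 (sub_self u)⟩

/-- The Suzuki group `Sz(q)`, `q = 2 ^ (2 * e + 1) = |F|`: the group of all (linear) collineations
of the projective space of `F⁴` that preserve the Suzuki-Tits ovoid. As `t ↦ t⁴` is a bijection of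
the finite field `F` of characteristic two, each linear collineation is induced by exactly one
matrix of determinant `1`, and the group is realized by these matrices. -/
abbrev suzukiGroup (F : Type*) [Field F] (e : ℕ) : Subgroup SL(4, F) :=
  MulAction.stabilizer SL(4, F) (suzukiTitsOvoid F e)

/-! ### Hyperbolic pairs, anisotropic complements and singular vectors. -/

section QuadraticSpace

open QuadraticMap

variable {F V : Type*} [Field F] [AddCommGroup V] [Module F V]

/-! Two vertices lie on a common singular line exactly when they are equal or adjacent, and `κ` has
no totally singular plane. Hence every automorphism of the affine polar graph maps singular lines to
singular lines and preserves their parallelism (`IsConformal.parallel`). As singular vectors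
generate `V`, it is a translation composed with an additive map (`IsConformal.map_add_sub`), which
is semilinear and, when linear, multiplies `κ` by a constant.

Suppose `Sz(q)` embeds in the automorphism group, and take linear parts on a Sylow 2-subgroup. The
degree of `F` over its prime field is odd, and in characteristic two the only root of unity of
two-power order is 1, so these linear parts are linear isometries (`isIsometricAction_of_isPGroup`).
Counting modulo 2, they have a common fixed singular vector `a ≠ 0` and a common fixed nonzero
vector in the plane `a^⊥ / a`. The action on this plane has a kernel of index at most 2, and each
isometry in the kernel squares to 1. So among any `x`, `y`, `x * y`, one has a linear part with
trivial square (`exists_map_map_eq_self`).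

In `Sz(q)` with `q > 2`, one can choose `x`, `y`, `x * y` all of order 4. Some square `T ≠ 1` then
acts as a translation, and so does its conjugate by the swap. Translations commute, but these two
matrices do not (`suzukiUnipotent_not_commute`).

The graphs are not isomorphic because `Sz(q)` acts faithfully on `VSz(q)`. -/

/-- The properties of a non-singular quadratic form of minus type on a four-dimensional space
that control its singular vectors. -/
structure IsElliptic (κ : QuadraticForm F V) : Prop where
  finrank_eq : Module.finrank F V = 4
  exists_singular : ∃ a, a ≠ 0 ∧ κ a = 0
  exists_partner : ∀ a, a ≠ 0 → κ a = 0 → ∃ b, κ b = 0 ∧ polar κ a b = 1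
  eq_smul : ∀ a y, a ≠ 0 → κ a = 0 → κ y = 0 → polar κ a y = 0 → ∃ t : F, y = t • a

variable {κ : QuadraticForm F V}

theorem map_add_eq (κ : QuadraticForm F V) (x y : V) :
    κ (x + y) = κ x + κ y + polar κ x y :=
  QuadraticMap.map_add κ x y

theorem map_sub_eq (κ : QuadraticForm F V) (x y : V) :
    κ (x - y) = κ x + κ y - polar κ x y := by
  rw [sub_eq_add_neg, map_add_eq, QuadraticMap.map_neg, polar_neg_right]
  ring

theorem map_smul_eq (κ : QuadraticForm F V) (t : F) (x : V) : κ (t • x) = t * t * κ x := by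
  rw [QuadraticMap.map_smul, smul_eq_mul]

theorem polar_self_of_singular {a : V} (ha : κ a = 0) : polar κ a a = 0 := by
  rw [polar_self, ha, smul_zero]

/-- Non-singularity supplies a vector not orthogonal to `a`, which can be corrected to a singular
one. Two independent orthogonal singular vectors would span a totally singular plane, against Witt
index 1. -/
theorem IsNonsingularOfMinusType.isElliptic (h : IsNonsingularOfMinusType κ 2) :
    IsElliptic κ := by
  obtain ⟨hd, hr, k, hk, ⟨W, hW, hWk⟩, hmax⟩ := h
  obtain rfl : k = 1 := by omega
  have hfin : Module.Finite F V := Module.finite_of_finrank_pos (by omega)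
  refine ⟨hd, ?_, ?_, ?_⟩
  · have : Nontrivial W := Module.nontrivial_of_finrank_pos (R := F) (by omega)
    obtain ⟨w, hw⟩ := exists_ne (0 : W)
    exact ⟨w, by simpa using hw, hW w w.2⟩
  · intro a ha h0
    have hex : ∃ c, polar κ a c ≠ 0 := by
      by_contra! hc
      have : a ∈ κ.radical := by
        rw [mem_radical_iff']
        refine ⟨h0, fun n => ?_⟩
        rw [map_add_eq, h0, hc n]
        ring
      rw [hr] at this
      exact ha (by simpa using this)
    obtain ⟨c, hc⟩ := hex
    -- Scale `c` to polar value 1 with `a`. Subtracting `t • a` then lowers the form by `t`, so `t`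
    -- is the value of the form on the scaled vector.
    refine ⟨(polar κ a c)⁻¹ • c - ((polar κ a c)⁻¹ ^ 2 * κ c) • a, ?_, ?_⟩
    · simp only [map_sub_eq, map_smul_eq, polar_smul_left, polar_smul_right, smul_eq_mul, h0,
        polar_comm κ c a]
      field_simp
      ring
    · simp only [polar_sub_right, polar_smul_right, smul_eq_mul, polar_self_of_singular h0]
      field_simp
      ring
  · intro a y ha h0 hy hp
    have hts : IsTotallySingular κ (Submodule.span F {a, y}) := by
      intro x hx
      obtain ⟨s, t, rfl⟩ := Submodule.mem_span_pair.1 hx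
      simp [map_add_eq, map_smul_eq, polar_smul_left, polar_smul_right, h0, hy, hp]
    have h1 := hmax _ hts
    by_contra! hne
    have hli : LinearIndependent F ![a, y] := by
      rw [LinearIndependent.pair_iff' ha]
      exact fun t ht => hne t ht.symm
    have h2 := finrank_span_eq_card hli
    rw [Matrix.range_cons_cons_empty] at h2
    simp at h2
    omega

theorem map_sub_of_singular {a b : V} (ha : κ a = 0) (hb : κ b = 0) :
    κ (a - b) = - polar κ a b := by
  rw [map_sub_eq, ha, hb]
  ring

/-- A hyperbolic pair: two singular vectors with polar value one. -/
structure IsHyperbolicPair (κ : QuadraticForm F V) (a b : V) : Prop where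
  left : κ a = 0
  right : κ b = 0
  polar_eq : polar κ a b = 1

/-- The component of `v` orthogonal to the hyperbolic pair `a`, `b`. -/
def orthogonalPart (κ : QuadraticForm F V) (a b v : V) : V :=
  v - polar κ v b • a - polar κ v a • b

namespace IsHyperbolicPair

variable {a b : V}

theorem symm (h : IsHyperbolicPair κ a b) : IsHyperbolicPair κ b a :=
  ⟨h.right, h.left, by rw [polar_comm, h.polar_eq]⟩

theorem left_ne_zero (h : IsHyperbolicPair κ a b) : a ≠ 0 := by
  rintro rfl
  simpa using h.polar_eq

theorem polar_orthogonalPart_left (h : IsHyperbolicPair κ a b) (v : V) :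
    polar κ (orthogonalPart κ a b v) a = 0 := by
  simp [orthogonalPart, polar_sub_left, polar_smul_left, polar_self_of_singular h.left,
    h.symm.polar_eq]

theorem polar_orthogonalPart_right (h : IsHyperbolicPair κ a b) (v : V) :
    polar κ (orthogonalPart κ a b v) b = 0 := by
  simp [orthogonalPart, polar_sub_left, polar_smul_left, polar_self_of_singular h.right,
    h.polar_eq]

theorem decomposition (κ : QuadraticForm F V) (a b v : V) :
    v = polar κ v b • a + polar κ v a • b + orthogonalPart κ a b v := by
  rw [orthogonalPart]
  abel

/-- The value of the form on a vector given in coordinates. -/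
theorem map_coords (h : IsHyperbolicPair κ a b) (α β : F) {w : V} (hwa : polar κ w a = 0)
    (hwb : polar κ w b = 0) : κ (α • a + β • b + w) = α * β + κ w := by
  simp [map_add_eq, map_smul_eq, polar_smul_left, polar_smul_right, polar_add_left, h.left,
    h.right, h.polar_eq, polar_comm κ a w, polar_comm κ b w, hwa, hwb]
  ring

end IsHyperbolicPair

namespace IsElliptic

variable {a b : V}

theorem exists_hyperbolicPair (hκ : IsElliptic κ) : ∃ a b, IsHyperbolicPair κ a b := by
  obtain ⟨a, ha, h0⟩ := hκ.exists_singular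
  obtain ⟨b, hb, hab⟩ := hκ.exists_partner a ha h0
  exact ⟨a, b, h0, hb, hab⟩

/-- The orthogonal complement of a hyperbolic pair is anisotropic. -/
theorem eq_zero_of_orthogonal (hκ : IsElliptic κ) (h : IsHyperbolicPair κ a b) {w : V}
    (hwa : polar κ w a = 0) (hwb : polar κ w b = 0) (hw : κ w = 0) : w = 0 := by
  obtain ⟨t, rfl⟩ := hκ.eq_smul a w h.left_ne_zero h.left hw (by rw [polar_comm, hwa])
  rw [polar_smul_left, h.polar_eq, smul_eq_mul, mul_one] at hwb
  rw [hwb, zero_smul]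

theorem exists_orthogonal_notMem (hκ : IsElliptic κ) (h : IsHyperbolicPair κ a b) (c : V) :
    ∃ w, polar κ w a = 0 ∧ polar κ w b = 0 ∧ ∀ t : F, w ≠ t • c := by
  classical
  have hne : Submodule.span F ({a, b, c} : Set V) ≠ ⊤ := by
    intro htop
    have h1 := finrank_span_finset_le_card (R := F) ({a, b, c} : Finset V)
    have h2 : ({a, b, c} : Finset V).card ≤ 3 := Finset.card_le_three
    have h3 : (({a, b, c} : Finset V) : Set V) = {a, b, c} := by simp
    rw [Set.finrank, h3, htop, finrank_top, hκ.finrank_eq] at h1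
    omega
  obtain ⟨v, hv⟩ : ∃ v, v ∉ Submodule.span F ({a, b, c} : Set V) := by
    by_contra! hc
    exact hne (Submodule.eq_top_iff'.2 hc)
  refine ⟨orthogonalPart κ a b v, h.polar_orthogonalPart_left v, h.polar_orthogonalPart_right v,
    fun t ht => hv ?_⟩
  rw [IsHyperbolicPair.decomposition κ a b v, ht]
  refine add_mem (add_mem ?_ ?_) ?_ <;> refine Submodule.smul_mem _ _ (Submodule.subset_span ?_) <;>
    simp

theorem exists_orthogonal_ne_zero (hκ : IsElliptic κ) (h : IsHyperbolicPair κ a b) :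
    ∃ w, polar κ w a = 0 ∧ polar κ w b = 0 ∧ κ w ≠ 0 := by
  obtain ⟨w, hwa, hwb, hw⟩ := hκ.exists_orthogonal_notMem h 0
  exact ⟨w, hwa, hwb, fun h0 => hw 0 (by simpa using hκ.eq_zero_of_orthogonal h hwa hwb h0)⟩

theorem exists_sq_eq [Finite F] [CharP F 2] (x : F) : ∃ s, s * s = x := by
  obtain ⟨s, hs⟩ := (bijective_frobenius F 2).2 x
  exact ⟨s, by rw [← hs, frobenius_def, pow_two]⟩

/-- Every scalar is a square, so some `s • w` has the same form value as `v`. By orthogonality and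
characteristic two `v - s • w` is singular, and the complement is anisotropic. -/
theorem eq_smul_of_orthogonal [Finite F] [CharP F 2] (hκ : IsElliptic κ)
    (h : IsHyperbolicPair κ a b) {w v : V} (hwa : polar κ w a = 0) (hwb : polar κ w b = 0)
    (hva : polar κ v a = 0) (hvb : polar κ v b = 0) (hw : κ w ≠ 0) (hwv : polar κ v w = 0) :
    ∃ t : F, v = t • w := by
  obtain ⟨s, hs⟩ := exists_sq_eq (κ v / κ w)
  refine ⟨s, sub_eq_zero.1 (hκ.eq_zero_of_orthogonal h ?_ ?_ ?_)⟩
  · simp [polar_sub_left, polar_smul_left, hwa, hva]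
  · simp [polar_sub_left, polar_smul_left, hwb, hvb]
  · rw [map_sub_eq, map_smul_eq, polar_smul_right, hwv, smul_zero, sub_zero, hs,
      div_mul_cancel₀ _ hw, CharTwo.add_self_eq_zero]

/-- In the orthogonal complement of a hyperbolic pair, every non-zero vector has a partner with
polar value one, and the two span the complement. -/
theorem exists_orthogonal_partner [Finite F] [CharP F 2] (hκ : IsElliptic κ)
    (h : IsHyperbolicPair κ a b) {w : V} (hwa : polar κ w a = 0) (hwb : polar κ w b = 0)
    (hw : κ w ≠ 0) :
    ∃ z, polar κ z a = 0 ∧ polar κ z b = 0 ∧ polar κ w z = 1 ∧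
      ∀ v, polar κ v a = 0 → polar κ v b = 0 →
        v = polar κ v z • w + polar κ v w • z := by
  obtain ⟨z, hza, hzb, hz⟩ := hκ.exists_orthogonal_notMem h w
  have hne : polar κ z w ≠ 0 := fun h0 => by
    obtain ⟨t, ht⟩ := hκ.eq_smul_of_orthogonal h hwa hwb hza hzb hw h0
    exact hz t ht
  have hself : ∀ x : V, polar κ x x = 0 := fun x => by
    rw [polar_self, two_smul, CharTwo.add_self_eq_zero]
  have key : polar κ w ((polar κ z w)⁻¹ • z) = 1 := by
    rw [polar_smul_right, polar_comm κ w z, smul_eq_mul, inv_mul_cancel₀ hne]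
  refine ⟨(polar κ z w)⁻¹ • z, by simp [polar_smul_left, hza], by simp [polar_smul_left, hzb],
    key, fun v hva hvb => ?_⟩
  generalize hz' : (polar κ z w)⁻¹ • z = z' at key
  have hza' : polar κ z' a = 0 := by rw [← hz', polar_smul_left, hza, smul_zero]
  have hzb' : polar κ z' b = 0 := by rw [← hz', polar_smul_left, hzb, smul_zero]
  obtain ⟨t, ht⟩ := hκ.eq_smul_of_orthogonal h (v := v - polar κ v z' • w - polar κ v w • z')
    hwa hwb (by simp [polar_sub_left, polar_smul_left, hva, hwa, hza'])
    (by simp [polar_sub_left, polar_smul_left, hvb, hwb, hzb']) hw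
    (by simp [polar_sub_left, polar_smul_left, hself, polar_comm κ z' w, key])
  have h0 : polar κ (v - polar κ v z' • w - polar κ v w • z') z' = 0 := by
    simp [polar_sub_left, polar_smul_left, hself, key]
  rw [ht, polar_smul_left, key, smul_eq_mul, mul_one] at h0
  rw [h0, zero_smul, sub_sub, sub_eq_zero] at ht
  exact ht

/-- An additive subgroup containing all singular vectors not orthogonal to a given singular vector
is the whole space. -/
theorem addSubgroup_eq_top [Finite F] [CharP F 2] (hκ : IsElliptic κ) (hF : ∃ s : F, s ≠ 0 ∧ s ≠ 1)
    (ha : a ≠ 0) (h0 : κ a = 0) (G : AddSubgroup V)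
    (hG : ∀ y, κ y = 0 → polar κ a y ≠ 0 → y ∈ G) : G = ⊤ := by
  obtain ⟨b, hb, hab⟩ := hκ.exists_partner a ha h0
  have h : IsHyperbolicPair κ a b := ⟨h0, hb, hab⟩
  -- These are the singular vectors with prescribed nonzero `b`-coordinate `s` and orthogonal part
  -- `w`.
  have hgen : ∀ (s : F) (w : V), s ≠ 0 → polar κ w a = 0 → polar κ w b = 0 →
      (-κ w / s) • a + s • b + w ∈ G := fun s w hs hwa hwb => by
    refine hG _ ?_ ?_
    · rw [h.map_coords _ _ hwa hwb]
      field_simp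
      ring
    · simpa [polar_add_right, polar_smul_right, polar_self_of_singular h0, hab,
        polar_comm κ a w, hwa] using hs
  have hsb : ∀ s : F, s • b ∈ G := fun s => by
    by_cases hs : s = 0
    · simp [hs, G.zero_mem]
    · simpa using hgen s 0 hs (by simp) (by simp)
  have haw : ∀ (s : F) (w : V), s ≠ 0 → polar κ w a = 0 → polar κ w b = 0 →
      (-κ w / s) • a + w ∈ G := fun s w hs hwa hwb => by
    have := sub_mem (hgen s w hs hwa hwb) (hsb s)
    rwa [show (-κ w / s) • a + s • b + w - s • b = (-κ w / s) • a + w by abel] at this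
  obtain ⟨w, hwa, hwb, hw⟩ := hκ.exists_orthogonal_ne_zero h
  obtain ⟨s, hs0, hs1⟩ := hF
  have hta : ∀ t : F, t • a ∈ G := fun t => by
    have hs1' : s - 1 ≠ 0 := sub_ne_zero.2 hs1
    -- Comparing `haw` at `s` and at 1 for `r • w` leaves a multiple of `a` with coefficient `r²
    -- κ(w) (s - 1) / s`. This is where a scalar other than 0 and 1 is needed.
    obtain ⟨r, hr⟩ := exists_sq_eq (t / (κ w * ((s - 1) / s)))
    have hrwa : polar κ (r • w) a = 0 := by rw [polar_smul_left, hwa, smul_zero]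
    have hrwb : polar κ (r • w) b = 0 := by rw [polar_smul_left, hwb, smul_zero]
    have := sub_mem (haw s (r • w) hs0 hrwa hrwb) (haw 1 (r • w) one_ne_zero hrwa hrwb)
    rw [add_sub_add_right_eq_sub, ← sub_smul, map_smul_eq, hr] at this
    convert this using 2
    field_simp
    ring
  refine (AddSubgroup.eq_top_iff' G).2 fun v => ?_
  rw [IsHyperbolicPair.decomposition κ a b v]
  refine add_mem (add_mem (hta _) (hsb _)) ?_
  have := sub_mem (haw 1 _ one_ne_zero (h.polar_orthogonalPart_left v)
    (h.polar_orthogonalPart_right v)) (hta (-κ (orthogonalPart κ a b v) / 1))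
  rwa [add_sub_cancel_left] at this

end IsElliptic
end QuadraticSpace

/-! ### Graph automorphisms are affine semilinear maps. -/

section Conformal

open QuadraticMap

variable {F V : Type*} [Field F] [AddCommGroup V] [Module F V] {κ : QuadraticForm F V}

/-- A bijection preserving singularity of differences in both directions. -/
def IsConformal (κ : QuadraticForm F V) (ψ : V ≃ V) : Prop :=
  ∀ u v, κ (ψ u - ψ v) = 0 ↔ κ (u - v) = 0

namespace IsConformal

variable {ψ : V ≃ V} {a b c u v : V}

theorem symm (hψ : IsConformal κ ψ) : IsConformal κ ψ.symm := fun u v => by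
  simpa using (hψ (ψ.symm u) (ψ.symm v)).symm

theorem singular_sub (hψ : IsConformal κ ψ) (u : V) (ha : κ a = 0) :
    κ (ψ (u + a) - ψ u) = 0 :=
  (hψ _ _).2 (by rwa [add_sub_cancel_left])

theorem sub_ne_zero (ψ : V ≃ V) (u : V) (ha : a ≠ 0) : ψ (u + a) - ψ u ≠ 0 := by
  rw [_root_.sub_ne_zero]
  simpa using ha

/-- The images of three points on a singular line differ pairwise by singular vectors. Two of these
differences are then orthogonal, hence proportional. -/
theorem line (hκ : IsElliptic κ) (hψ : IsConformal κ ψ) (ha : κ a = 0) (u : V) (t : F) :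
    ∃ s : F, ψ (u + t • a) = ψ u + s • (ψ (u + a) - ψ u) := by
  by_cases ha0 : a = 0
  · exact ⟨0, by simp [ha0]⟩
  have hta : κ (t • a) = 0 := by rw [map_smul_eq, ha, mul_zero]
  have hc := hψ.singular_sub u ha
  have hy := hψ.singular_sub u hta
  have hd : κ (ψ (u + a) - ψ u - (ψ (u + t • a) - ψ u)) = 0 := by
    rw [sub_sub_sub_cancel_right, hψ, add_sub_add_left_eq_sub,
      show a - t • a = (1 - t) • a by rw [sub_smul, one_smul], map_smul_eq, ha, mul_zero]
  rw [map_sub_of_singular hc hy, neg_eq_zero] at hd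
  obtain ⟨s, hs⟩ := hκ.eq_smul _ _ (sub_ne_zero ψ u ha0) hc hy hd
  exact ⟨s, by rw [← hs]; abel⟩

theorem line_surjective (hκ : IsElliptic κ) (hψ : IsConformal κ ψ) (ha : κ a = 0) (u : V) (s : F) :
    ∃ t : F, ψ (u + t • a) = ψ u + s • (ψ (u + a) - ψ u) := by
  obtain ⟨t, ht⟩ := hψ.symm.line hκ (hψ.singular_sub u ha) (ψ u) s
  refine ⟨t, ?_⟩
  rw [add_sub_cancel, ψ.symm_apply_apply, ψ.symm_apply_apply, add_sub_cancel_left] at ht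
  rw [← ht, ψ.apply_symm_apply]

/-- Conformal bijections map parallel singular lines to parallel singular lines. -/
theorem parallel (hκ : IsElliptic κ) (hψ : IsConformal κ ψ) (ha : κ a = 0) (u v : V) :
    ∃ s : F, ψ (v + a) - ψ v = s • (ψ (u + a) - ψ u) := by
  by_cases ha0 : a = 0
  · exact ⟨0, by simp [ha0]⟩
  have hsu := hψ.line_surjective hκ ha u
  have hsv := hψ.line_surjective hκ ha v
  have hlu := hψ.line hκ ha u
  have hlv := hψ.line hκ ha v
  have hc := hψ.singular_sub u ha
  have hd := hψ.singular_sub v ha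
  have hc0 := sub_ne_zero ψ u ha0
  have hd0 := sub_ne_zero ψ v ha0
  generalize ψ (u + a) - ψ u = c at *
  generalize ψ (v + a) - ψ v = d at *
  refine hκ.eq_smul c d hc0 hc hd ?_
  by_contra hcd
  -- If the image directions `c`, `d` are not orthogonal, singularity of a difference between the
  -- image lines depends on both parameters through the nonzero term in `t * s`. Between the
  -- original parallel lines it depends on `t - s` only. The two incidence patterns are
  -- incompatible.
  have him : ∀ t s : F, κ (ψ u + t • c - (ψ v + s • d)) =
      κ (ψ u - ψ v) + t * polar κ (ψ u - ψ v) c - s * (polar κ (ψ u - ψ v) d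
        + t * polar κ c d) := fun t s => by
    rw [show ψ u + t • c - (ψ v + s • d) = (ψ u - ψ v) + t • c - s • d by abel]
    simp only [map_sub_eq κ _ (s • d), map_add_eq κ _ (t • c), map_smul_eq, hc, hd,
      polar_smul_right, polar_add_left, polar_smul_left, smul_eq_mul]
    ring
  have hpre : ∀ t s : F, κ (u + t • a - (v + s • a)) = κ (u - v) + (t - s) * polar κ (u - v) a :=
    fun t s => by
      rw [show u + t • a - (v + s • a) = (u - v) + (t - s) • a by rw [sub_smul]; abel, map_add_eq,
        map_smul_eq, ha, polar_smul_right, smul_eq_mul]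
      ring
  -- Here either all pairs of points on the two original lines are related or none are, whereas some
  -- image point is related to exactly one point of the other image line.
  by_cases hw : polar κ (u - v) a = 0
  · have hconst : ∀ t s : F, κ (ψ u + t • c - (ψ v + s • d)) = 0 ↔ κ (u - v) = 0 := fun t s => by
      obtain ⟨t', ht⟩ := hsu t
      obtain ⟨s', hs⟩ := hsv s
      rw [← ht, ← hs, hψ, hpre, hw, mul_zero, add_zero]
    obtain ⟨t, ht⟩ : ∃ t : F, polar κ (ψ u - ψ v) d + t * polar κ c d = 1 :=
      ⟨(1 - polar κ (ψ u - ψ v) d) / polar κ c d, by field_simp; ring⟩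
    have hall : ∀ t s : F, κ (ψ u + t • c - (ψ v + s • d)) = 0 := fun t' s' => by
      rw [hconst, ← hconst t (κ (ψ u - ψ v) + t * polar κ (ψ u - ψ v) c), him, ht]
      ring
    have h0 := hall t 0
    have h1 := hall t 1
    rw [him, ht] at h0 h1
    exact one_ne_zero (α := F) (by linear_combination h0 - h1)
  -- Here each point is related to exactly one point of the parallel line, whereas for this `t` the
  -- image point is related to all points of the other line or to none.
  · obtain ⟨t, ht⟩ : ∃ t : F, polar κ (ψ u - ψ v) d + t * polar κ c d = 0 :=
      ⟨-polar κ (ψ u - ψ v) d / polar κ c d, by field_simp; ring⟩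
    obtain ⟨t', ht'⟩ := hsu t
    obtain ⟨s₀, hs₀⟩ := hlv (t' + κ (u - v) / polar κ (u - v) a)
    have hz : ∀ s : F, κ (ψ u + t • c - (ψ v + s • d)) = 0 := by
      have h0 : κ (ψ u + t • c - (ψ v + s₀ • d)) = 0 := by
        rw [← ht', ← hs₀, hψ, hpre]
        field_simp
        ring
      intro s
      rw [him, ht] at h0 ⊢
      simpa using h0
    obtain ⟨s, hs⟩ := hsv 0
    obtain ⟨r, hr⟩ := hsv 1
    have h1 := hz 0
    have h2 := hz 1
    rw [← ht', ← hs, hψ, hpre] at h1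
    rw [← ht', ← hr, hψ, hpre] at h2
    have hsr : s = r := mul_right_cancel₀ hw (by linear_combination h2 - h1)
    rw [hsr, hr] at hs
    simp [hd0] at hs

/-- The parallelogram on `a`, `b` has image sides `A`, `s • A` and `B`, `r • B`. Closing it gives
`(s - 1) • A = (r - 1) • B`, and pairing with `B` forces `s = 1`. -/
theorem parallelogram (hκ : IsElliptic κ) (hψ : IsConformal κ ψ) (ha : κ a = 0) (hb : κ b = 0)
    (hab : polar κ a b ≠ 0) (u : V) : ψ (u + b + a) - ψ (u + b) = ψ (u + a) - ψ u := by
  obtain ⟨s, hs⟩ := hψ.parallel hκ ha u (u + b)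
  obtain ⟨r, hr⟩ := hψ.parallel hκ hb u (u + a)
  have hA := hψ.singular_sub u ha
  have hB := hψ.singular_sub u hb
  have hAB : polar κ (ψ (u + a) - ψ u) (ψ (u + b) - ψ u) ≠ 0 := by
    rw [← neg_ne_zero, ← map_sub_of_singular hA hB, sub_sub_sub_cancel_right, Ne, hψ,
      add_sub_add_left_eq_sub, map_sub_of_singular ha hb, neg_eq_zero]
    exact hab
  have h1 : (s - 1) • (ψ (u + a) - ψ u) = (r - 1) • (ψ (u + b) - ψ u) := by
    rw [sub_smul, sub_smul, one_smul, one_smul, ← hs, ← hr, add_right_comm u a b]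
    abel
  have h2 := congrArg (fun x => polar κ x (ψ (u + b) - ψ u)) h1
  simp only [polar_smul_left, polar_self_of_singular hB, smul_eq_mul, mul_zero] at h2
  have h3 : s = 1 := sub_eq_zero.1 ((mul_eq_zero.1 h2).resolve_right hAB)
  rw [hs, h3, one_smul]

variable [Finite F] [CharP F 2]

/-- The `v` by which the base point may always be shifted form an additive subgroup. By
`parallelogram` it contains every singular vector not orthogonal to `a`, so it is everything. -/
theorem map_add_singular (hκ : IsElliptic κ) (hF : ∃ s : F, s ≠ 0 ∧ s ≠ 1) (hψ : IsConformal κ ψ)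
    (ha : κ a = 0) (u v : V) : ψ (u + v + a) - ψ (u + v) = ψ (u + a) - ψ u := by
  by_cases ha0 : a = 0
  · simp [ha0]
  let G : AddSubgroup V :=
    { carrier := {v | ∀ u, ψ (u + v + a) - ψ (u + v) = ψ (u + a) - ψ u}
      zero_mem' := fun u => by simp
      add_mem' := fun {x y} hx hy u => by rw [← add_assoc, hy, hx]
      neg_mem' := fun {x} hx u => by simpa using (hx (u + -x)).symm }
  have hG : G = ⊤ := hκ.addSubgroup_eq_top hF ha0 ha G
    fun y hy hay u => hψ.parallelogram hκ ha hy hay u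
  exact (hG ▸ AddSubgroup.mem_top v : v ∈ G) u

/-- Conformal bijections are additive up to a translation. -/
theorem map_add_sub (hκ : IsElliptic κ) (hF : ∃ s : F, s ≠ 0 ∧ s ≠ 1) (hψ : IsConformal κ ψ)
    (u v : V) : ψ (u + v) - ψ u = ψ v - ψ 0 := by
  obtain ⟨a, ha0, ha⟩ := hκ.exists_singular
  let G : AddSubgroup V :=
    { carrier := {v | ∀ u, ψ (u + v) - ψ u = ψ v - ψ 0}
      zero_mem' := fun u => by simp
      add_mem' := fun {x y} hx hy u => by
        rw [← sub_add_sub_cancel (ψ (u + (x + y))) (ψ (u + x)), ← add_assoc, hy, hx,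
          ← sub_add_sub_cancel (ψ (x + y)) (ψ x), hy]
      neg_mem' := fun {x} hx u => by
        have h1 := hx (u + -x)
        have h2 := hx (-x)
        rw [neg_add_cancel_right] at h1
        rw [neg_add_cancel] at h2
        rw [← neg_sub, h1, ← h2, neg_sub] }
  have hG : G = ⊤ := hκ.addSubgroup_eq_top hF ha0 ha G fun y hy _ u => by
    simpa using hψ.map_add_singular hκ hF hy 0 u
  exact (hG ▸ AddSubgroup.mem_top v : v ∈ G) u

end IsConformal

/-- An additive conformal bijection. -/
structure IsAddConformal (κ : QuadraticForm F V) (L : V ≃+ V) : Prop where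
  singular_iff : ∀ v, κ (L v) = 0 ↔ κ v = 0

namespace IsAddConformal

variable {L : V ≃+ V} {a b c x y : V}

theorem isConformal (hL : IsAddConformal κ L) : IsConformal κ L.toEquiv := fun u v => by
  simpa using hL.singular_iff (u - v)

theorem map_smul_singular (hκ : IsElliptic κ) (hL : IsAddConformal κ L) (ha : κ a = 0) (t : F) :
    ∃ s : F, L (t • a) = s • L a := by
  simpa using hL.isConformal.line hκ ha 0 t

theorem smul_map_singular (hκ : IsElliptic κ) (hL : IsAddConformal κ L) (ha : κ a = 0) (s : F) :
    ∃ t : F, L (t • a) = s • L a := by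
  simpa using hL.isConformal.line_surjective hκ ha 0 s

/-- Otherwise the line through `L x` in direction `L y` contains a singular vector `L (x + t • y)`.
Then `x` is itself singular, hence a multiple of `y`, so `L x` is a multiple of the singular vector
`L y`. -/
theorem polar_eq_zero (hκ : IsElliptic κ) (hL : IsAddConformal κ L) (hy : κ y = 0)
    (hxy : polar κ x y = 0) : polar κ (L x) (L y) = 0 := by
  by_contra hne
  have hy0 : y ≠ 0 := by
    rintro rfl
    simp at hne
  have hLy := (hL.singular_iff y).2 hy
  obtain ⟨t, ht⟩ := hL.smul_map_singular hκ hy (-κ (L x) / polar κ (L x) (L y))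
  have h1 : κ (L (x + t • y)) = 0 := by
    rw [map_add, ht, map_add_eq, map_smul_eq, hLy, polar_smul_right, smul_eq_mul]
    field_simp
    ring
  rw [hL.singular_iff, map_add_eq, map_smul_eq, hy, polar_smul_right, hxy] at h1
  obtain ⟨r, rfl⟩ := hκ.eq_smul y x hy0 hy (by simpa using h1) (by rw [polar_comm, hxy])
  obtain ⟨s, hs⟩ := hL.map_smul_singular hκ hy r
  rw [hs, polar_smul_left, polar_self_of_singular hLy, smul_zero] at hne
  exact hne rfl

theorem polar_ne_zero (hL : IsAddConformal κ L) (ha : κ a = 0) (hb : κ b = 0)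
    (hab : polar κ a b ≠ 0) : polar κ (L a) (L b) ≠ 0 := by
  rw [← neg_ne_zero, ← map_sub_of_singular ((hL.singular_iff a).2 ha) ((hL.singular_iff b).2 hb),
    ← map_sub, Ne, hL.singular_iff, map_sub_of_singular ha hb, neg_eq_zero]
  exact hab

/-- Both `a - c` and its `t`-multiple are orthogonal to `b`. Orthogonality to `L b` survives under
`L`, which equates the two scalars. -/
theorem map_smul_of_common (hκ : IsElliptic κ) (hL : IsAddConformal κ L) (ha : κ a = 0)
    (hc : κ c = 0) (hb : κ b = 0) (hab : polar κ a b ≠ 0) (hcb : polar κ c b = polar κ a b)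
    {t s : F} (hs : L (t • a) = s • L a) : L (t • c) = s • L c := by
  obtain ⟨r, hr⟩ := hL.map_smul_singular hκ hc t
  have h1 : polar κ (L (a - c)) (L b) = 0 :=
    hL.polar_eq_zero hκ hb (by rw [polar_sub_left, hcb, sub_self])
  have h2 : polar κ (L (t • a - t • c)) (L b) = 0 :=
    hL.polar_eq_zero hκ hb (by rw [polar_sub_left, polar_smul_left, polar_smul_left, hcb, sub_self])
  rw [map_sub, polar_sub_left, sub_eq_zero] at h1
  rw [map_sub, polar_sub_left, hs, hr, polar_smul_left, polar_smul_left, ← h1, ← sub_smul,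
    smul_eq_mul] at h2
  have h3 : s = r :=
    sub_eq_zero.1 ((mul_eq_zero.1 h2).resolve_right (hL.polar_ne_zero ha hb hab))
  rw [hr, h3]

variable [Finite F] [CharP F 2]

theorem map_smul_of_not_orthogonal (hκ : IsElliptic κ) (hL : IsAddConformal κ L) (ha : κ a = 0)
    (hc : κ c = 0) (hac : polar κ a c ≠ 0) {t s : F} (hs : L (t • a) = s • L a) :
    L (t • c) = s • L c := by
  have h : IsHyperbolicPair κ a ((polar κ a c)⁻¹ • c) :=
    ⟨ha, by rw [map_smul_eq, hc, mul_zero], by rw [polar_smul_right, smul_eq_mul,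
      inv_mul_cancel₀ hac]⟩
  obtain ⟨w, hwa, hwb, hw⟩ := hκ.exists_orthogonal_ne_zero h
  have hwc : polar κ w c = 0 := by
    rw [polar_smul_right, smul_eq_mul] at hwb
    exact (mul_eq_zero.1 hwb).resolve_left (inv_ne_zero hac)
  -- This choice makes `r • a + r • c + w` singular. Its polar values with `a` and `c` agree by
  -- symmetry.
  obtain ⟨r, hr⟩ := IsElliptic.exists_sq_eq (-κ w * (polar κ a c)⁻¹)
  have hr0 : r ≠ 0 := by
    rintro rfl
    rw [zero_mul, eq_comm, mul_eq_zero, neg_eq_zero] at hr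
    exact hr.elim hw (inv_ne_zero hac)
  refine hL.map_smul_of_common hκ ha hc (b := r • a + r • c + w) ?_ ?_ ?_ hs
  · simp only [map_add_eq, map_smul_eq, polar_smul_left, polar_smul_right, polar_add_left, ha, hc,
      polar_comm κ a w, polar_comm κ c w, hwa, hwc, smul_eq_mul]
    field_simp at hr
    linear_combination hr
  · simp only [polar_add_right, polar_smul_right, polar_self_of_singular ha, polar_comm κ a w, hwa,
      smul_eq_mul, mul_zero, zero_add, add_zero]
    exact mul_ne_zero hr0 hac
  · simp only [polar_add_right, polar_smul_right, polar_self_of_singular ha, polar_comm κ a w, hwa,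
      smul_eq_mul, mul_zero, zero_add, add_zero, polar_self_of_singular hc, polar_comm κ c w, hwc,
      polar_comm κ c a]

/-- Additive conformal bijections are semilinear. -/
theorem exists_map_smul (hκ : IsElliptic κ) (hF : ∃ s : F, s ≠ 0 ∧ s ≠ 1)
    (hL : IsAddConformal κ L) (t : F) : ∃ s : F, ∀ x, L (t • x) = s • L x := by
  obtain ⟨a, b, h⟩ := hκ.exists_hyperbolicPair
  obtain ⟨s, hs⟩ := hL.map_smul_singular hκ h.left t
  have hb : L (t • b) = s • L b :=
    hL.map_smul_of_not_orthogonal hκ h.left h.right (by simp [h.polar_eq]) hs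
  let G : AddSubgroup V :=
    { carrier := {x | L (t • x) = s • L x}
      zero_mem' := by simp
      add_mem' := fun {x y} hx hy => by
        change L (t • x) = s • L x at hx
        change L (t • y) = s • L y at hy
        change L (t • (x + y)) = s • L (x + y)
        rw [smul_add, map_add, map_add, smul_add, hx, hy]
      neg_mem' := fun {x} hx => by
        change L (t • x) = s • L x at hx
        change L (t • -x) = s • L (-x)
        rw [smul_neg, map_neg, map_neg, smul_neg, hx] }
  have hG : G = ⊤ := hκ.addSubgroup_eq_top hF h.left_ne_zero h.left G fun y hy hay =>
    hL.map_smul_of_not_orthogonal hκ h.left hy hay hs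
  exact ⟨s, fun x => (hG ▸ AddSubgroup.mem_top x : x ∈ G)⟩

omit [Finite F] [CharP F 2] in
/-- Linear conformal bijections are similarities. -/
theorem exists_multiplier (hκ : IsElliptic κ) (hL : IsAddConformal κ L)
    (hlin : ∀ (t : F) x, L (t • x) = t • L x) : ∃ μ : F, ∀ x, κ (L x) = μ * κ x := by
  obtain ⟨a, b, h⟩ := hκ.exists_hyperbolicPair
  refine ⟨polar κ (L a) (L b), fun x => ?_⟩
  have hLa := (hL.singular_iff a).2 h.left
  have hLb := (hL.singular_iff b).2 h.right
  have hwa := h.polar_orthogonalPart_left x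
  have hwb := h.polar_orthogonalPart_right x
  have hx := IsHyperbolicPair.decomposition κ a b x
  generalize orthogonalPart κ a b x = w at *
  have hexp : ∀ α β : F, κ (L (α • a + β • b + w)) =
      α * β * polar κ (L a) (L b) + κ (L w) := fun α β => by
    have h1 := hL.polar_eq_zero hκ h.left hwa
    have h2 := hL.polar_eq_zero hκ h.right hwb
    simp only [map_add, hlin, map_add_eq, map_smul_eq, polar_add_left, polar_smul_left,
      polar_smul_right, hLa, hLb, polar_comm κ (L a) (L w), polar_comm κ (L b) (L w), h1, h2,
      smul_eq_mul]
    ring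
  -- This singular vector has singular image, which determines `κ (L w)` from `κ w`.
  have hw : κ (L ((-κ w) • a + (1 : F) • b + w)) = 0 :=
    (hL.singular_iff _).2 (by rw [h.map_coords _ _ hwa hwb]; ring)
  rw [hexp] at hw
  rw [hx, hexp, h.map_coords _ _ hwa hwb]
  linear_combination hw

end IsAddConformal
end Conformal

/-! ### Two-groups of isometries. -/

section TwoGroups

open QuadraticMap

theorem IsPGroup.exists_fixed_of_odd {P X : Type*} [Group P] (hP : IsPGroup 2 P)
    (act : P → X → X) (h1 : ∀ x, act 1 x = x) (hmul : ∀ p q x, act (p * q) x = act p (act q x))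
    (hodd : Odd (Nat.card X)) : ∃ x, ∀ p, act p x = x := by
  let : MulAction P X := { smul := act, one_smul := h1, mul_smul := hmul }
  obtain ⟨x, hx⟩ := hP.nonempty_fixed_point_of_prime_not_dvd_card X
    (by rwa [← even_iff_two_dvd, Nat.not_even_iff_odd])
  exact ⟨x, hx⟩

variable {F V : Type*} [Field F] [AddCommGroup V] [Module F V] {κ : QuadraticForm F V}

/-- A field automorphism of two-power order of a field of order `2 ^ n`, `n` odd, is trivial. -/
theorem ringHom_eq_id_of_iterate_two_pow [Finite F] [CharP F 2] {n : ℕ} (hn : Odd n)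
    (hF : Nat.card F = 2 ^ n) (θ : F →+* F) (k : ℕ) (hθ : ∀ t, θ^[2 ^ k] t = t) (t : F) :
    θ t = t := by
  have : Fact (Nat.Prime 2) := ⟨Nat.prime_two⟩
  let : Algebra (ZMod 2) F := ZMod.algebra F 2
  have hdim : Module.finrank (ZMod 2) F = n := by
    have h := Module.natCard_eq_pow_finrank (K := ZMod 2) (V := F)
    rw [hF, Nat.card_zmod] at h
    exact (Nat.pow_right_injective le_rfl h).symm
  let f : F →ₐ[ZMod 2] F :=
    { θ with
      commutes' := fun r => RingHom.congr_fun
        (Subsingleton.elim (θ.comp (algebraMap (ZMod 2) F)) (algebraMap (ZMod 2) F)) r }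
  let g : F ≃ₐ[ZMod 2] F := AlgEquiv.ofBijective f (Finite.injective_iff_bijective.1 θ.injective)
  have hiter : ∀ (m : ℕ) (x : F), (g ^ m) x = θ^[m] x := fun m => by
    induction m with
    | zero => intro x; rfl
    | succ m ih =>
      intro x
      rw [pow_succ, AlgEquiv.mul_apply, ih, Function.iterate_succ_apply]
      rfl
  have h1 : g ^ 2 ^ k = 1 := AlgEquiv.ext fun x => by rw [hiter, hθ]; rfl
  -- The Galois group over the prime field has order `n`, which is odd.
  have h2 : g ^ n = 1 := by
    have h := pow_card_eq_one' (x := g)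
    rwa [IsGalois.card_aut_eq_finrank, hdim] at h
  have h3 : orderOf g = 1 := Nat.eq_one_of_dvd_coprimes
    (Nat.Coprime.pow_left k (Nat.coprime_two_left.2 hn)) (orderOf_dvd_of_pow_eq_one h1)
    (orderOf_dvd_of_pow_eq_one h2)
  exact AlgEquiv.congr_fun (orderOf_eq_one_iff.1 h3) t

/-- The orthogonal complement of the vectors `a` and `b`. -/
def pairOrthogonal (κ : QuadraticForm F V) (a b : V) : AddSubgroup V where
  carrier := {w | polar κ w a = 0 ∧ polar κ w b = 0}
  zero_mem' := by simp
  add_mem' := fun {x y} hx hy => by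
    constructor <;> simp [polar_add_left, hx.1, hx.2, hy.1, hy.2]
  neg_mem' := fun {x} hx => by constructor <;> simp [polar_neg_left, hx.1, hx.2]

namespace IsElliptic

variable [Finite F] [CharP F 2] {a b : V}

omit [CharP F 2] in
theorem finite (hκ : IsElliptic κ) : Finite V := by
  have : Module.Finite F V := Module.finite_of_finrank_pos (by rw [hκ.finrank_eq]; norm_num)
  exact Module.finite_of_finite F

omit [Finite F] in
theorem add_self_vec (F : Type*) [Field F] [CharP F 2] [Module F V] (v : V) : v + v = 0 := by
  rw [← two_smul F, CharTwo.two_eq_zero, zero_smul]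

theorem even_card_pairOrthogonal (hκ : IsElliptic κ) (h : IsHyperbolicPair κ a b) :
    Even (Nat.card (pairOrthogonal κ a b)) := by
  have := hκ.finite
  obtain ⟨w, hwa, hwb, hw⟩ := hκ.exists_orthogonal_ne_zero h
  have hord : addOrderOf (⟨w, hwa, hwb⟩ : pairOrthogonal κ a b) = 2 := by
    refine addOrderOf_eq_prime (Subtype.ext ?_) fun h0 => hw ?_
    · rw [two_nsmul]
      exact add_self_vec F w
    · rw [show w = 0 from congrArg Subtype.val h0, QuadraticMap.map_zero]
  rw [even_iff_two_dvd, ← hord]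
  exact addOrderOf_dvd_natCard _

theorem odd_card_nonzero_pairOrthogonal (hκ : IsElliptic κ) (h : IsHyperbolicPair κ a b) :
    Odd (Nat.card {w : pairOrthogonal κ a b // w ≠ 0}) := by
  classical
  have := hκ.finite
  have h1 := Nat.card_congr (Equiv.optionSubtypeNe (0 : pairOrthogonal κ a b))
  have h2 := hκ.even_card_pairOrthogonal h
  rw [← h1, Finite.card_option] at h2
  exact Nat.not_even_iff_odd.1 fun h3 => by simp [Nat.even_add_one, h3] at h2

theorem odd_card_units [Fact (Nat.Prime 2)] : Odd (Nat.card Fˣ) := by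
  classical
  have := Fintype.ofFinite F
  obtain ⟨n, -, hn⟩ := FiniteField.card F 2
  rw [Nat.card_units, Nat.card_eq_fintype_card, hn]
  exact Nat.Even.sub_odd Nat.one_le_two_pow (by simp [Nat.even_pow]) odd_one

/-- Up to a unique nonzero scalar, a nonzero singular vector is `a` or `-κ(w) a + b + w` with `w` in
the complement of the pair. The number of scalars is odd and the complement has even size. -/
theorem odd_card_singular (hκ : IsElliptic κ) :
    Odd (Nat.card {v : V // v ≠ 0 ∧ κ v = 0}) := by
  have : Fact (Nat.Prime 2) := ⟨Nat.prime_two⟩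
  have := hκ.finite
  obtain ⟨a, b, h⟩ := hκ.exists_hyperbolicPair
  let f : Fˣ × Option (pairOrthogonal κ a b) → V := fun x =>
    x.2.elim ((x.1 : F) • a) fun w => (x.1 : F) • ((-κ w.1) • a + (1 : F) • b + w.1)
  have hf0 : ∀ t, polar κ (f (t, none)) a = 0 := fun t => by
    simp [f, polar_smul_left, polar_self_of_singular h.left]
  have hf1 : ∀ t w, polar κ (f (t, some w)) a = t := fun t w => by
    simp [f, polar_smul_left, polar_add_left, polar_self_of_singular h.left, h.symm.polar_eq, w.2.1]
  have hfs : ∀ x, κ (f x) = 0 := by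
    rintro ⟨t, _ | w⟩
    · simp [f, map_smul_eq, h.left]
    · simp only [f, Option.elim]
      rw [map_smul_eq, h.map_coords _ _ w.2.1 w.2.2]
      ring
  have hfn : ∀ x, f x ≠ 0 := by
    rintro ⟨t, _ | w⟩ h0
    · exact h.left_ne_zero (by simpa [f] using h0)
    · simpa [h0] using (hf1 t w).symm
  have hbij : Function.Bijective (fun x => (⟨f x, hfn x, hfs x⟩ : {v : V // v ≠ 0 ∧ κ v = 0})) := by
    constructor
    · rintro ⟨t, o⟩ ⟨s, o'⟩ hxy
      replace hxy : f (t, o) = f (s, o') := congrArg Subtype.val hxy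
      have hp := congrArg (fun v => polar κ v a) hxy
      rcases o with _ | w <;> rcases o' with _ | w' <;> simp only [hf0, hf1] at hp
      · have hts := congrArg (fun v => polar κ v b) hxy
        simp only [f, Option.elim, polar_smul_left, h.polar_eq, smul_eq_mul, mul_one] at hts
        rw [Units.ext hts]
      · exact absurd hp.symm s.ne_zero
      · exact absurd hp t.ne_zero
      · obtain rfl := Units.ext hp
        have hw : (-κ w.1) • a + (1 : F) • b + w.1 = (-κ w'.1) • a + (1 : F) • b + w'.1 := by
          have := congrArg (fun v => (t : F)⁻¹ • v) hxy
          simpa only [f, Option.elim, inv_smul_smul₀ t.ne_zero] using this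
        have hk := congrArg (fun v => polar κ v b) hw
        simp only [polar_add_left, polar_smul_left, h.polar_eq, polar_self_of_singular h.right,
          w.2.2, w'.2.2, smul_eq_mul, mul_one, mul_zero, add_zero] at hk
        rw [hk, add_right_inj] at hw
        rw [Subtype.ext hw]
    · rintro ⟨v, hv0, hv⟩
      by_cases hva : polar κ v a = 0
      · obtain ⟨t, rfl⟩ := hκ.eq_smul a v h.left_ne_zero h.left hv (by rw [polar_comm, hva])
        have ht : t ≠ 0 := by
          rintro rfl
          simp at hv0
        exact ⟨(Units.mk0 t ht, none), rfl⟩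
      · have hva' := h.polar_orthogonalPart_left v
        have hvb' := h.polar_orthogonalPart_right v
        have hdec := IsHyperbolicPair.decomposition κ a b v
        generalize orthogonalPart κ a b v = w at *
        refine ⟨(Units.mk0 _ hva, some ⟨(polar κ v a)⁻¹ • w, ?_, ?_⟩), Subtype.ext ?_⟩
        · rw [polar_smul_left, hva', smul_zero]
        · rw [polar_smul_left, hvb', smul_zero]
        · rw [hdec, h.map_coords _ _ hva' hvb'] at hv
          have hκw : κ w = -(polar κ v b * polar κ v a) := by linear_combination hv
          refine Eq.trans ?_ hdec.symm
          simp only [f, Option.elim, Units.val_mk0, map_smul_eq, hκw, smul_add, smul_smul,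
            mul_inv_cancel₀ hva, one_smul]
          congr 3
          field_simp
  rw [← Nat.card_congr (Equiv.ofBijective _ hbij), Nat.card_prod, Finite.card_option]
  exact odd_card_units.mul (hκ.even_card_pairOrthogonal h).add_one

end IsElliptic

/-- An action of a group by linear isometries. -/
structure IsIsometricAction {P : Type*} [Group P] (κ : QuadraticForm F V)
    (L : P → V ≃+ V) : Prop where
  map_one : ∀ x, L 1 x = x
  map_mul : ∀ p q x, L (p * q) x = L p (L q x)
  map_smul : ∀ p (t : F) x, L p (t • x) = t • L p x
  map_form : ∀ p x, κ (L p x) = κ x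

namespace IsIsometricAction

variable {P : Type*} [Group P] {L : P → V ≃+ V} {a b : V}

theorem polar_map (hL : IsIsometricAction κ L) (p : P) (x y : V) :
    polar κ (L p x) (L p y) = polar κ x y := by
  simp only [polar, ← map_add, hL.map_form]

variable [Finite F] [CharP F 2]

theorem exists_fixed_singular (hκ : IsElliptic κ) (hP : IsPGroup 2 P)
    (hL : IsIsometricAction κ L) : ∃ a, a ≠ 0 ∧ κ a = 0 ∧ ∀ p, L p a = a := by
  obtain ⟨⟨a, ha, h0⟩, hfix⟩ := hP.exists_fixed_of_odd (X := {v : V // v ≠ 0 ∧ κ v = 0})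
    (fun p v => ⟨L p v, by simpa using v.2.1, by rw [hL.map_form, v.2.2]⟩)
    (fun v => Subtype.ext (hL.map_one _)) (fun p q v => Subtype.ext (hL.map_mul p q _)) hκ.odd_card_singular
  exact ⟨a, ha, h0, fun p => congrArg Subtype.val (hfix p)⟩

omit [Finite F] [CharP F 2] in
theorem map_orthogonal (hL : IsIsometricAction κ L) {p : P} (hp : L p a = a) {w : V}
    (hwa : polar κ w a = 0) :
    L p w = polar κ (L p w) b • a + orthogonalPart κ a b (L p w) := by
  have h := IsHyperbolicPair.decomposition κ a b (L p w)
  have h0 : polar κ (L p w) a = 0 := by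
    have := hL.polar_map p w a
    rwa [hp, hwa] at this
  rwa [h0, zero_smul, add_zero] at h

/-- The complement of the pair is a model of `a^⊥ / a`, via projection along `a`. The group acts on
its nonzero vectors, which are odd in number. -/
theorem exists_fixed_orthogonal (hκ : IsElliptic κ) (hP : IsPGroup 2 P)
    (hL : IsIsometricAction κ L) (h : IsHyperbolicPair κ a b) (hfix : ∀ p, L p a = a) :
    ∃ w, polar κ w a = 0 ∧ polar κ w b = 0 ∧ κ w ≠ 0 ∧
      ∀ p, L p w = polar κ (L p w) b • a + w := by
  have hadd : ∀ x (t : F), orthogonalPart κ a b (t • a + x) = orthogonalPart κ a b x :=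
    fun x t => by
      simp only [orthogonalPart, polar_add_left, polar_smul_left, polar_self_of_singular h.left,
        h.polar_eq, smul_eq_mul, mul_zero, mul_one, zero_add, add_smul]
      abel
  have hne : ∀ (p : P) (w : {w : pairOrthogonal κ a b // w ≠ 0}),
      orthogonalPart κ a b (L p w.1.1) ≠ 0 := fun p w h0 => by
    have h1 := hL.map_orthogonal (b := b) (hfix p) w.1.2.1
    rw [h0, add_zero] at h1
    have h2 := hL.map_form p w.1.1
    rw [h1, map_smul_eq, h.left, mul_zero] at h2
    exact w.2 (Subtype.ext (hκ.eq_zero_of_orthogonal h w.1.2.1 w.1.2.2 h2.symm))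
  obtain ⟨⟨⟨w, hwa, hwb⟩, hw0⟩, hw⟩ :=
    hP.exists_fixed_of_odd (X := {w : pairOrthogonal κ a b // w ≠ 0})
    (fun p w => ⟨⟨orthogonalPart κ a b (L p w.1.1), h.polar_orthogonalPart_left _,
      h.polar_orthogonalPart_right _⟩, fun h0 => hne p w (congrArg Subtype.val h0)⟩)
    (fun w => by
      refine Subtype.ext (Subtype.ext ?_)
      simp [hL.map_one, orthogonalPart, w.1.2.1, w.1.2.2])
    (fun p q w => by
      refine Subtype.ext (Subtype.ext ?_)
      change orthogonalPart κ a b (L (p * q) w.1.1) =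
        orthogonalPart κ a b (L p (orthogonalPart κ a b (L q w.1.1)))
      conv_lhs => rw [hL.map_mul, hL.map_orthogonal (b := b) (hfix q) w.1.2.1, map_add,
        hL.map_smul, hfix, hadd])
    (hκ.odd_card_nonzero_pairOrthogonal h)
  refine ⟨w, hwa, hwb, fun h0 => hw0 (Subtype.ext (hκ.eq_zero_of_orthogonal h hwa hwb h0)),
    fun p => ?_⟩
  have h1 : orthogonalPart κ a b (L p w) = w :=
    congrArg (fun x : {w : pairOrthogonal κ a b // w ≠ 0} => x.1.1) (hw p)
  conv_lhs => rw [hL.map_orthogonal (b := b) (hfix p) hwa, h1]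

omit [Finite F] in
/-- An isometry fixing a singular vector `a` and acting trivially on `a^⊥ / a` is an involution. -/
theorem map_map_eq_self (hL : IsIsometricAction κ L) (h : IsHyperbolicPair κ a b) {p : P}
    (hfix : L p a = a) (hw : ∀ w, polar κ w a = 0 → polar κ w b = 0 →
      L p w = polar κ (L p w) b • a + w) (v : V) : L p (L p v) = v := by
  have h2 := IsElliptic.add_self_vec (V := V) F
  have hself : ∀ x : V, polar κ x x = 0 := fun x => by
    rw [polar_self, two_smul, CharTwo.add_self_eq_zero]
  have horth : ∀ w, polar κ w a = 0 → polar κ w b = 0 → L p (L p w) = w := fun w hwa hwb => by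
    obtain ⟨c, hc⟩ : ∃ c : F, L p w = c • a + w := ⟨_, hw w hwa hwb⟩
    rw [hc, map_add, hL.map_smul, hfix, hc, ← add_assoc, h2, zero_add]
  have hb : L p (L p b) = b := by
    have hba : polar κ (L p b) a = 1 := by
      have := hL.polar_map p b a
      rwa [hfix, h.symm.polar_eq] at this
    have hwa := h.polar_orthogonalPart_left (L p b)
    have hwb := h.polar_orthogonalPart_right (L p b)
    have hdec := IsHyperbolicPair.decomposition κ a b (L p b)
    rw [hba, one_smul] at hdec
    generalize orthogonalPart κ a b (L p b) = w at *
    generalize polar κ (L p b) b = ν at *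
    have hLw := hw w hwa hwb
    -- Since `b ⊥ w`, also `L b ⊥ L w`. With `L b = ν a + b + w`, this pairing is exactly the
    -- `a`-coordinate of `L w`, so `w` is fixed.
    have hl : polar κ (L p w) b = 0 := by
      have := hL.polar_map p b w
      rw [polar_comm κ b w, hwb, hLw, hdec] at this
      simpa [polar_add_left, polar_add_right, polar_smul_left, polar_smul_right, hself,
        h.symm.polar_eq, polar_comm κ a w, hwa, polar_comm κ b w, hwb] using this
    rw [hl, zero_smul, zero_add] at hLw
    rw [hdec, map_add, map_add, hL.map_smul, hfix, hLw, hdec]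
    rw [show ν • a + (ν • a + b + w) + w = (ν • a + ν • a) + b + (w + w) by abel, h2, h2]
    simp
  rw [IsHyperbolicPair.decomposition κ a b v]
  simp only [map_add, hL.map_smul, hfix, hb,
    horth _ (h.polar_orthogonalPart_left v) (h.polar_orthogonalPart_right v)]

/-- Among two elements of a two-group of isometries and their product, one is an involution or
trivial. -/
theorem exists_map_map_eq_self (hκ : IsElliptic κ) (hP : IsPGroup 2 P)
    (hL : IsIsometricAction κ L) (x y : P) :
    ∃ g, (g = x ∨ g = y ∨ g = x * y) ∧ ∀ v, L g (L g v) = v := by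
  obtain ⟨a, ha, h0, hfix⟩ := hL.exists_fixed_singular hκ hP
  obtain ⟨b, hb, hab⟩ := hκ.exists_partner a ha h0
  have h : IsHyperbolicPair κ a b := ⟨h0, hb, hab⟩
  obtain ⟨w, hwa, hwb, hw, hLw⟩ := hL.exists_fixed_orthogonal hκ hP h hfix
  obtain ⟨z, hza, hzb, hwz, hspan⟩ := hκ.exists_orthogonal_partner h hwa hwb hw
  have hself : ∀ x : V, polar κ x x = 0 := fun x => by
    rw [polar_self, two_smul, CharTwo.add_self_eq_zero]
  have hLz : ∀ p, L p z = polar κ (L p z) b • a + (polar κ (L p z) z • w + z) := fun p => by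
    have h1 := hL.map_orthogonal (b := b) (hfix p) hza
    have hva := h.polar_orthogonalPart_left (L p z)
    have hvb := h.polar_orthogonalPart_right (L p z)
    have h2 := hspan _ hva hvb
    generalize orthogonalPart κ a b (L p z) = v at *
    have hvw : polar κ v w = 1 := by
      have := hL.polar_map p z w
      rw [polar_comm κ z w, hwz, h1, hLw p] at this
      simpa [polar_add_left, polar_add_right, polar_smul_left, polar_smul_right, hself,
        polar_comm κ a w, hwa, hva] using this
    have hvz : polar κ (L p z) z = polar κ v z := by
      rw [h1, polar_add_left, polar_smul_left, polar_comm κ a z, hza, smul_zero, zero_add]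
    rw [hvw, one_smul] at h2
    rw [hvz, ← h2]
    exact h1
  -- The `w`-coordinate of `L p z` takes only the values 0 and `1 / κ(w)`, because `L p` preserves
  -- `κ z`. It is additive in `p` by `hadd`, so two nonzero values cancel in the product.
  have hα : ∀ p, polar κ (L p z) z * (polar κ (L p z) z * κ w + 1) = 0 := fun p => by
    have h1 := hL.map_form p z
    rw [hLz p] at h1
    simp only [map_add_eq, map_smul_eq, polar_smul_left, polar_smul_right,
      polar_add_right, h0, polar_comm κ a w, polar_comm κ a z, hwa, hza, hwz, smul_eq_mul] at h1
    linear_combination h1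
  have hadd : ∀ p q, polar κ (L (p * q) z) z = polar κ (L q z) z + polar κ (L p z) z := by
    intro p q
    rw [hL.map_mul, hLz q]
    simp only [map_add, hL.map_smul, hfix, polar_add_left, polar_smul_left]
    rw [hLw p]
    simp [polar_add_left, polar_smul_left, polar_comm κ a z, hza, hwz, hself]
  have hgood : ∀ p, polar κ (L p z) z = 0 → ∀ v, L p (L p v) = v := fun p hp =>
    hL.map_map_eq_self h (hfix p) fun v hva hvb => by
      have hz := hLz p
      rw [hp, zero_smul, zero_add] at hz
      have hv := hspan v hva hvb
      have hLv : L p v = (polar κ v z * polar κ (L p w) b + polar κ v w * polar κ (L p z) b) • a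
          + v := by
        conv_lhs => rw [hv, map_add, hL.map_smul, hL.map_smul, hLw p, hz]
        conv_rhs => rw [hv]
        simp only [smul_add, add_smul, smul_smul, polar_add_left, polar_smul_left, hself, hwz,
          polar_comm κ z w, smul_eq_mul, mul_one, mul_zero, add_zero, zero_add]
        abel
      have hc : polar κ (L p v) b =
          polar κ v z * polar κ (L p w) b + polar κ v w * polar κ (L p z) b := by
        conv_lhs => rw [hLv]
        simp [polar_add_left, polar_smul_left, hab, hvb]
      rw [hc]
      exact hLv
  by_cases hx : polar κ (L x z) z = 0
  · exact ⟨x, Or.inl rfl, hgood x hx⟩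
  by_cases hy : polar κ (L y z) z = 0
  · exact ⟨y, Or.inr (Or.inl rfl), hgood y hy⟩
  refine ⟨x * y, Or.inr (Or.inr rfl), hgood _ ?_⟩
  have h1 := (mul_eq_zero.1 (hα x)).resolve_left hx
  have h2 := (mul_eq_zero.1 (hα y)).resolve_left hy
  have h3 : polar κ (L x z) z = polar κ (L y z) z :=
    mul_right_cancel₀ hw (by linear_combination h1 - h2)
  rw [hadd, h3, CharTwo.add_self_eq_zero]

end IsIsometricAction
end TwoGroups

/-! ### Unipotent elements and the swap in the Suzuki group. -/

section Suzuki

variable {F : Type*} [Field F]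

/-- The endomorphism `t ↦ t ^ (2 ^ (e + 1))`. -/
def titsEndomorphism (F : Type*) [Field F] [CharP F 2] (e : ℕ) : F →+* F :=
  iterateFrobenius F 2 (e + 1)

theorem titsEndomorphism_apply [CharP F 2] (e : ℕ) (t : F) :
    titsEndomorphism F e t = t ^ 2 ^ (e + 1) :=
  iterateFrobenius_def ..

/-- The exponent of the square is `2 ^ (2e + 2) = 2q`, and `t ^ q = t`. -/
theorem titsEndomorphism_apply_apply [CharP F 2] {e : ℕ} (hF : Nat.card F = 2 ^ (2 * e + 1))
    (t : F) : titsEndomorphism F e (titsEndomorphism F e t) = t ^ 2 := by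
  have : Finite F := Nat.finite_of_card_ne_zero (by rw [hF]; positivity)
  have := Fintype.ofFinite F
  rw [titsEndomorphism_apply, titsEndomorphism_apply, ← pow_mul, ← pow_add,
    show e + 1 + (e + 1) = 2 * e + 1 + 1 by ring, pow_succ, pow_mul, ← hF,
    Nat.card_eq_fintype_card, FiniteField.pow_card]

/-- The matrices of the Sylow two-subgroup of the Suzuki group fixing the point `(0 : 0 : 1 : 0)`. -/
def suzukiUnipotent (σ : F →+* F) (a b : F) : SL(4, F) :=
  ⟨!![1, 0, 0, a; σ a, 1, 0, b; b + a * σ a, a, 1, a * b + a ^ 2 * σ a + σ b; 0, 0, 0, 1], by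
    simp [Matrix.det_succ_row_zero, Fin.sum_univ_succ, Fin.succAbove]⟩

/-- The permutation matrix interchanging `(0 : 0 : 1 : 0)` and `(0 : 0 : 0 : 1)`. -/
def suzukiSwap (F : Type*) [Field F] : SL(4, F) :=
  ⟨!![0, 1, 0, 0; 1, 0, 0, 0; 0, 0, 0, 1; 0, 0, 1, 0], by
    simp [Matrix.det_succ_row_zero, Fin.sum_univ_succ, Fin.succAbove]⟩

theorem coe_suzukiUnipotent (σ : F →+* F) (a b : F) :
    (suzukiUnipotent σ a b : Matrix (Fin 4) (Fin 4) F) =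
      !![1, 0, 0, a; σ a, 1, 0, b; b + a * σ a, a, 1, a * b + a ^ 2 * σ a + σ b; 0, 0, 0, 1] :=
  rfl

theorem coe_suzukiSwap : (suzukiSwap F : Matrix (Fin 4) (Fin 4) F) =
    !![0, 1, 0, 0; 1, 0, 0, 0; 0, 0, 0, 1; 0, 0, 1, 0] :=
  rfl

theorem specialLinearGroup_smul_eq_mulVec (g : SL(4, F)) (v : Fin 4 → F) :
    g • v = (g : Matrix (Fin 4) (Fin 4) F).mulVec v :=
  rfl

theorem suzukiUnipotent_smul (σ : F →+* F) (a b x y z t : F) :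
    suzukiUnipotent σ a b • ![x, y, z, t] =
      ![x + a * t, σ a * x + y + b * t,
        (b + a * σ a) * x + a * y + z + (a * b + a ^ 2 * σ a + σ b) * t, t] := by
  rw [specialLinearGroup_smul_eq_mulVec, coe_suzukiUnipotent]
  ext i
  fin_cases i <;> simp [Matrix.mulVec, dotProduct, Fin.sum_univ_succ] <;> ring

theorem suzukiSwap_smul (x y z t : F) : suzukiSwap F • ![x, y, z, t] = ![y, x, t, z] := by
  rw [specialLinearGroup_smul_eq_mulVec, coe_suzukiSwap]
  ext i
  fin_cases i <;> simp [Matrix.mulVec, dotProduct, Fin.sum_univ_succ]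

theorem specialLinearGroup_ext_smul {g h : SL(4, F)}
    (hgh : ∀ x y z t : F, g • ![x, y, z, t] = h • ![x, y, z, t]) : g = h := by
  refine Subtype.ext (Matrix.mulVec_injective (funext fun v => ?_))
  have := hgh (v 0) (v 1) (v 2) (v 3)
  rwa [show ![v 0, v 1, v 2, v 3] = v by ext i; fin_cases i <;> rfl] at this

theorem suzukiSwap_mul_self : suzukiSwap F * suzukiSwap F = 1 :=
  specialLinearGroup_ext_smul fun x y z t => by
    rw [mul_smul, suzukiSwap_smul, suzukiSwap_smul, one_smul]

theorem suzukiUnipotent_zero (σ : F →+* F) : suzukiUnipotent σ 0 0 = 1 :=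
  specialLinearGroup_ext_smul fun x y z t => by
    rw [suzukiUnipotent_smul, one_smul]
    simp

theorem suzukiUnipotent_mul [CharP F 2] {σ : F →+* F} (hσ : ∀ t, σ (σ t) = t ^ 2) (a b c d : F) :
    suzukiUnipotent σ a b * suzukiUnipotent σ c d =
      suzukiUnipotent σ (a + c) (b + d + c * σ a) := by
  have h2 : (2 : F) = 0 := CharTwo.two_eq_zero
  refine specialLinearGroup_ext_smul fun x y z t => ?_
  rw [mul_smul, suzukiUnipotent_smul, suzukiUnipotent_smul, suzukiUnipotent_smul]
  simp only [map_add, map_mul, hσ]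
  congr 1
  · ring
  congr 1
  · ring
  congr 1
  grind

/-- Apply both products to `(0, 0, 0, 1)`: the first coordinates are `0` and `b * σ b`. -/
theorem suzukiUnipotent_not_commute {σ : F →+* F} {b : F} (hb : b ≠ 0) :
    suzukiUnipotent σ 0 b * (suzukiSwap F * suzukiUnipotent σ 0 b * suzukiSwap F) ≠
      suzukiSwap F * suzukiUnipotent σ 0 b * suzukiSwap F * suzukiUnipotent σ 0 b := by
  intro h
  have h1 := congrArg (fun g : SL(4, F) => (g • ![0, 0, 0, 1] : Fin 4 → F) 0) h
  simp [mul_smul, suzukiUnipotent_smul, suzukiSwap_smul, hb] at h1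

theorem mk_mem_suzukiTitsOvoid_of_eq_smul {e : ℕ} {v : Fin 4 → F} (hv : v ≠ 0) {c x y z : F}
    (hvc : v = c • ![x, y, z, 1])
    (hz : z = x * y + x ^ 2 * x ^ (2 ^ (e + 1)) + y ^ (2 ^ (e + 1))) :
    Projectivization.mk F v hv ∈ suzukiTitsOvoid F e := by
  refine Or.inr ⟨x, y, z, fun h => ?_, hz, ?_⟩
  · simpa using congrFun h 3
  · rw [Projectivization.mk_eq_mk_iff']
    exact ⟨c, hvc.symm⟩

/-- On a finite set, mapping the ovoid into itself is enough to stabilize it. -/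
theorem mem_suzukiGroup_of_forall [Finite F] {e : ℕ} {g : SL(4, F)}
    (h : ∀ (v : Fin 4 → F) (_ : v ≠ 0) (hgv : g • v ≠ 0),
      (v = ![0, 0, 1, 0] ∨ ∃ x y z, v = ![x, y, z, 1] ∧
        z = x * y + x ^ 2 * x ^ (2 ^ (e + 1)) + y ^ (2 ^ (e + 1))) →
      Projectivization.mk F (g • v) hgv ∈ suzukiTitsOvoid F e) :
    g ∈ suzukiGroup F e := by
  have : Finite (ℙ F (Fin 4 → F)) := Quotient.finite _
  rw [MulAction.mem_stabilizer_set' (Set.toFinite _)]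
  rintro p (⟨h0, rfl⟩ | ⟨x, y, z, h0, hz, rfl⟩)
  · exact h _ h0 _ (Or.inl rfl)
  · exact h _ h0 _ (Or.inr ⟨x, y, z, rfl, hz⟩)

variable [CharP F 2] {e : ℕ}

theorem suzukiUnipotent_mem [Finite F] (hF : Nat.card F = 2 ^ (2 * e + 1)) (a b : F) :
    suzukiUnipotent (titsEndomorphism F e) a b ∈ suzukiGroup F e := by
  have hσσ := titsEndomorphism_apply_apply hF
  have h2 : (2 : F) = 0 := CharTwo.two_eq_zero
  refine mem_suzukiGroup_of_forall ?_
  rintro v hv hgv (rfl | ⟨x, y, z, rfl, hz⟩)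
  · refine Or.inl ⟨hv, ?_⟩
    congr 1
    rw [suzukiUnipotent_smul]
    simp
  · simp only [← titsEndomorphism_apply] at hz
    generalize hσ : titsEndomorphism F e = σ at *
    refine mk_mem_suzukiTitsOvoid_of_eq_smul hgv (c := 1) (x := x + a) (y := y + σ a * x + b)
      (z := z + (b + a * σ a) * x + a * y + (a * b + a ^ 2 * σ a + σ b)) ?_ ?_
    · rw [suzukiUnipotent_smul, one_smul]
      simp only [mul_one]
      congr 2
      · ring
      congr 1
      ring
    · simp only [← titsEndomorphism_apply, hσ, map_add, map_mul, hσσ]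
      rw [hz]
      grind

theorem suzukiSwap_mem [Finite F] (hF : Nat.card F = 2 ^ (2 * e + 1)) :
    suzukiSwap F ∈ suzukiGroup F e := by
  have hσσ := titsEndomorphism_apply_apply hF
  have h2 : (2 : F) = 0 := CharTwo.two_eq_zero
  refine mem_suzukiGroup_of_forall ?_
  rintro v hv hgv (rfl | ⟨x, y, z, rfl, hz⟩)
  · refine mk_mem_suzukiTitsOvoid_of_eq_smul hgv (c := 1) (x := 0) (y := 0) (z := 0) ?_ (by simp)
    rw [suzukiSwap_smul, one_smul]
  · have hgv' := suzukiSwap_smul x y z 1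
    simp only [← titsEndomorphism_apply] at hz
    have hσ := titsEndomorphism_apply (F := F) e
    generalize titsEndomorphism F e = σ at *
    have hσz : σ z = σ x * σ y + σ x ^ 2 * x ^ 2 + y ^ 2 := by
      rw [hz]
      simp only [map_add, map_mul, map_pow, hσσ]
    -- This is the ovoid equation for the swapped point `(y/z : x/z : 1/z : 1)` with denominators
    -- cleared. At `z = 0` it forces `x = y = 0`.
    have key : z * σ z = x * y * σ z + y ^ 2 * σ y + σ x * z ^ 2 := by
      rw [hσz, hz]
      grind
    by_cases h0 : z = 0
    · rw [h0, map_zero] at key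
      have hy : y = 0 := by
        have : y ^ 2 * σ y = 0 := by linear_combination -key
        simpa using this
      have hx : x = 0 := by
        rw [hy, h0] at hz
        simpa using hz.symm
      refine Or.inl ⟨by simp, ?_⟩
      simp only [hx, hy, h0, suzukiSwap_smul]
    · refine mk_mem_suzukiTitsOvoid_of_eq_smul hgv (c := z) (x := y / z) (y := x / z)
        (z := 1 / z) ?_ ?_
      · rw [hgv']
        ext i
        fin_cases i <;> simp [mul_div_cancel₀ _ h0, h0]
      · have hσz0 : σ z ≠ 0 := by simpa using h0
        simp only [← hσ, map_div₀]
        field_simp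
        linear_combination key

/-- The Sylow two-subgroup of the Suzuki group formed by the unipotent matrices. -/
def suzukiSylow (hF : Nat.card F = 2 ^ (2 * e + 1)) : Subgroup (suzukiGroup F e) where
  carrier := {g | ∃ a b, (g : SL(4, F)) = suzukiUnipotent (titsEndomorphism F e) a b}
  one_mem' := ⟨0, 0, (suzukiUnipotent_zero _).symm⟩
  mul_mem' := by
    rintro _ _ ⟨a, b, h⟩ ⟨c, d, h'⟩
    exact ⟨_, _, by rw [Subgroup.coe_mul, h, h',
      suzukiUnipotent_mul (titsEndomorphism_apply_apply hF)]⟩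
  inv_mem' := by
    rintro g ⟨a, b, h⟩
    refine ⟨a, b + a * titsEndomorphism F e a, ?_⟩
    rw [Subgroup.coe_inv, h, inv_eq_iff_mul_eq_one,
      suzukiUnipotent_mul (titsEndomorphism_apply_apply hF), ← suzukiUnipotent_zero]
    congr 1
    · exact CharTwo.add_self_eq_zero a
    · rw [← add_assoc, CharTwo.add_self_eq_zero, zero_add, CharTwo.add_self_eq_zero]

/-- Elements with `a ≠ 0` thus have nontrivial square, in contrast with the isometries supplied by
`exists_map_map_eq_self`. -/
theorem suzukiUnipotent_mul_self (hF : Nat.card F = 2 ^ (2 * e + 1)) (a b : F) :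
    suzukiUnipotent (titsEndomorphism F e) a b * suzukiUnipotent (titsEndomorphism F e) a b =
      suzukiUnipotent (titsEndomorphism F e) 0 (a * titsEndomorphism F e a) := by
  rw [suzukiUnipotent_mul (titsEndomorphism_apply_apply hF), CharTwo.add_self_eq_zero,
    CharTwo.add_self_eq_zero, zero_add]

theorem isPGroup_suzukiSylow (hF : Nat.card F = 2 ^ (2 * e + 1)) :
    IsPGroup 2 (suzukiSylow hF) := by
  rintro ⟨g, a, b, h⟩
  refine ⟨2, Subtype.ext (Subtype.ext ?_)⟩
  change (g : SL(4, F)) ^ 2 ^ 2 = 1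
  rw [h, show 2 ^ 2 = 2 * 2 by rfl, pow_mul, pow_two, pow_two, suzukiUnipotent_mul_self hF,
    suzukiUnipotent_mul_self hF, zero_mul, suzukiUnipotent_zero]

end Suzuki

/-! ### The Suzuki group does not act faithfully on the affine polar graph. -/

section Main

open QuadraticMap

variable {F V : Type*} [Field F] [AddCommGroup V] [Module F V] {κ : QuadraticForm F V}

theorem isConformal_of_graphIso (φ : affinePolarGraph κ ≃g affinePolarGraph κ) :
    IsConformal κ φ.toEquiv := fun u v => by
  by_cases h : u = v
  · simp [h]
  have h1 : (affinePolarGraph κ).Adj (φ u) (φ v) ↔ (affinePolarGraph κ).Adj u v :=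
    φ.map_rel_iff
  have h2 : φ u ≠ φ v := fun h' => h (φ.injective h')
  exact ⟨fun h0 => (h1.1 ⟨h2, h0⟩).2, fun h0 => (h1.2 ⟨h, h0⟩).2⟩

variable [Finite F] [CharP F 2]

/-- The additive part of a conformal bijection. -/
def IsConformal.linearPart {ψ : V ≃ V} (hψ : IsConformal κ ψ) (hκ : IsElliptic κ)
    (hF : ∃ s : F, s ≠ 0 ∧ s ≠ 1) : V ≃+ V where
  toFun v := ψ v - ψ 0
  invFun v := ψ.symm (v + ψ 0)
  left_inv v := by simp
  right_inv v := by simp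
  map_add' u v := by
    rw [← hψ.map_add_sub hκ hF u v]
    abel

theorem IsConformal.isAddConformal_linearPart {ψ : V ≃ V} (hψ : IsConformal κ ψ)
    (hκ : IsElliptic κ) (hF : ∃ s : F, s ≠ 0 ∧ s ≠ 1) :
    IsAddConformal κ (hψ.linearPart hκ hF) :=
  ⟨fun v => (hψ v 0).trans (by rw [sub_zero])⟩

/-- Over a field of order `2 ^ n`, `n` odd, every two-group of additive conformal bijections acts
by linear isometries. -/
theorem isIsometricAction_of_isPGroup {P : Type*} [Group P] (hP : IsPGroup 2 P)
    (hκ : IsElliptic κ) (hF : ∃ s : F, s ≠ 0 ∧ s ≠ 1) {n : ℕ} (hn : Odd n)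
    (hcard : Nat.card F = 2 ^ n) {L : P → V ≃+ V} (h1 : ∀ x, L 1 x = x)
    (hmul : ∀ p q x, L (p * q) x = L p (L q x)) (hL : ∀ p, IsAddConformal κ (L p)) :
    IsIsometricAction κ L := by
  have hlin : ∀ p (t : F) x, L p (t • x) = t • L p x := by
    intro p
    choose θ hθ using (hL p).exists_map_smul hκ hF
    obtain ⟨a, ha, -⟩ := hκ.exists_singular
    have ha' : L p a ≠ 0 := by simpa using ha
    let f : F →+* F :=
      { toFun := θ
        map_zero' := smul_left_injective F ha' (by
          change θ 0 • L p a = (0 : F) • L p a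
          rw [← hθ, zero_smul, zero_smul, map_zero])
        map_one' := smul_left_injective F ha' (by
          change θ 1 • L p a = (1 : F) • L p a
          rw [← hθ, one_smul, one_smul])
        map_add' := fun s t => smul_left_injective F ha' (by
          change θ (s + t) • L p a = (θ s + θ t) • L p a
          rw [← hθ, add_smul, map_add, hθ, hθ, add_smul])
        map_mul' := fun s t => smul_left_injective F ha' (by
          change θ (s * t) • L p a = (θ s * θ t) • L p a
          rw [← hθ, mul_smul, hθ, hθ, mul_smul]) }
    obtain ⟨k, hk⟩ := hP p
    have hiter : ∀ m t, L (p ^ m) (t • a) = f^[m] t • L (p ^ m) a := fun m => by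
      induction m with
      | zero => intro t; simp [h1]
      | succ m ih =>
        intro t
        rw [pow_succ', hmul, hmul, ih, hθ, Function.iterate_succ_apply']
        rfl
    -- The companion field endomorphism inherits the two-power order of `p`.
    have hid := ringHom_eq_id_of_iterate_two_pow hn hcard f k fun t =>
      smul_left_injective F ha (by
        change f^[2 ^ k] t • a = t • a
        have := hiter (2 ^ k) t
        rw [hk, h1, h1] at this
        exact this.symm)
    intro t x
    rw [hθ]
    exact congrArg (· • L p x) (hid t)
  refine ⟨h1, hmul, hlin, fun p => ?_⟩
  obtain ⟨μ, hμ⟩ := (hL p).exists_multiplier hκ (hlin p)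
  obtain ⟨a, b, h⟩ := hκ.exists_hyperbolicPair
  obtain ⟨k, hk⟩ := hP p
  have hiter : ∀ m x, κ (L (p ^ m) x) = μ ^ m * κ x := fun m => by
    induction m with
    | zero => intro x; simp [h1]
    | succ m ih =>
      intro x
      rw [pow_succ', hmul, hμ, ih]
      ring
  have hμk : μ ^ 2 ^ k = 1 := by
    -- The form takes the value 1 at `a + b`.
    have := hiter (2 ^ k) (a + b)
    rw [hk, h1, map_add_eq, h.left, h.right, h.polar_eq] at this
    simpa using this.symm
  have hμ1 : μ = 1 := iterateFrobenius_inj F 2 k (by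
    rwa [iterateFrobenius_def, iterateFrobenius_def, one_pow])
  intro x
  rw [hμ, hμ1, one_mul]

omit [Finite F] [CharP F 2] in
theorem exists_ne_zero_ne_one {e : ℕ} (he : 1 ≤ e) (hF : Nat.card F = 2 ^ (2 * e + 1)) :
    ∃ s : F, s ≠ 0 ∧ s ≠ 1 := by
  by_contra! hs
  have h1 : (Set.univ : Set F) ⊆ {0, 1} := fun s _ => by
    by_cases h : s = 0
    · exact Or.inl h
    · exact Or.inr (hs s h)
  have h2 := (Set.ncard_le_ncard h1).trans (Set.ncard_insert_le 0 {1})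
  rw [Set.ncard_univ, hF, Set.ncard_singleton] at h2
  have h3 : 2 ^ 3 ≤ 2 ^ (2 * e + 1) := Nat.pow_le_pow_right two_pos (by omega)
  omega

/-- The Suzuki group does not embed into the automorphism group of the affine polar graph. -/
theorem not_injective_suzukiGroup {e : ℕ} (he : 1 ≤ e) (hF : Nat.card F = 2 ^ (2 * e + 1))
    (hκ : IsElliptic κ)
    (J : suzukiGroup F e →* (affinePolarGraph κ ≃g affinePolarGraph κ)) :
    ¬ Function.Injective J := by
  intro hJ
  have hs := exists_ne_zero_ne_one he hF
  have hconf : ∀ g, IsConformal κ (J g).toEquiv := fun g => isConformal_of_graphIso (J g)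
  have hadd : ∀ g u v, J g (u + v) = J g u + (J g v - J g 0) := fun g u v => by
    have h : J g (u + v) - J g u = J g v - J g 0 := (hconf g).map_add_sub hκ hs u v
    rw [← h]
    abel
  have hJmul : ∀ g h v, J (g * h) v = J g (J h v) := fun g h v => by
    rw [map_mul]
    rfl
  let L : suzukiSylow hF → V ≃+ V := fun p => (hconf p).linearPart hκ hs
  have hLapp : ∀ p v, L p v = J p v - J p 0 := fun p v => rfl
  have hL : IsIsometricAction κ L := by
    refine isIsometricAction_of_isPGroup (isPGroup_suzukiSylow hF) hκ hs (n := 2 * e + 1) ⟨e, rfl⟩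
      hF (fun x => ?_) (fun p q x => ?_) (fun p => (hconf p).isAddConformal_linearPart hκ hs)
    · rw [hLapp, Subgroup.coe_one, map_one]
      exact sub_zero x
    · rw [hLapp, hLapp, hLapp, Subgroup.coe_mul, hJmul, hJmul]
      have := hadd p (J q 0) (J q x - J q 0)
      rw [add_sub_cancel] at this
      rw [this]
      abel
  obtain ⟨s, hs0, hs1⟩ := hs
  -- The first parameters of `u 1`, `u s` and their product are `1`, `s` and `1 + s`, all nonzero.
  let u : F → suzukiSylow hF := fun a => ⟨⟨_, suzukiUnipotent_mem hF a 0⟩, a, 0, rfl⟩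
  obtain ⟨g, hg, hgg⟩ := hL.exists_map_map_eq_self hκ (isPGroup_suzukiSylow hF) (u 1) (u s)
  obtain ⟨a, b, ha, hgab⟩ : ∃ a b, a ≠ 0 ∧
      ((g : suzukiGroup F e) : SL(4, F)) = suzukiUnipotent (titsEndomorphism F e) a b := by
    rcases hg with rfl | rfl | rfl
    · exact ⟨1, 0, one_ne_zero, rfl⟩
    · exact ⟨s, 0, hs0, rfl⟩
    · refine ⟨1 + s, _, fun h => hs1 ?_, suzukiUnipotent_mul (titsEndomorphism_apply_apply hF) ..⟩
      rw [← sub_eq_zero, CharTwo.sub_eq_add, add_comm, h]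
  let w : suzukiGroup F e := ⟨suzukiSwap F, suzukiSwap_mem hF⟩
  have hww : w * w = 1 := Subtype.ext suzukiSwap_mul_self
  let T : suzukiGroup F e := (g : suzukiGroup F e) * g
  -- The linear part of `T = g * g` is trivial, so `T` acts as a translation.
  have hT : ∀ v, J T v = v + J T 0 := fun v => by
    have h := hgg v
    rw [← hL.map_mul, hLapp, Subgroup.coe_mul] at h
    rw [← sub_eq_iff_eq_add, h]
  have hT' : ∀ v, J (w * T * w) v = v + (J w (J T 0) - J w 0) := fun v => by
    rw [hJmul, hJmul, hT, hadd, ← hJmul, hww, map_one]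
    rfl
  have hcomm : T * (w * T * w) = w * T * w * T := hJ (RelIso.ext fun v => by
    rw [hJmul T, hJmul _ T, hT, hT', hT', hT v]
    abel)
  have hTc : (T : SL(4, F)) =
      suzukiUnipotent (titsEndomorphism F e) 0 (a * titsEndomorphism F e a) := by
    rw [← suzukiUnipotent_mul_self hF a b, ← hgab]
    rfl
  have hfin := congrArg (Subtype.val : suzukiGroup F e → SL(4, F)) hcomm
  simp only [Subgroup.coe_mul, hTc] at hfin
  exact suzukiUnipotent_not_commute (mul_ne_zero ha (by simpa using ha)) hfin

end Main

/-! ### Faithful action on the Suzuki–Tits graph, and transport along an isomorphism. -/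

section SuzukiTitsGraph

variable {F : Type*} [Field F] {e : ℕ}

theorem suzukiTitsGraph_adj_smul (g : suzukiGroup F e) (u v : Fin 4 → F) :
    (suzukiTitsGraph F e).Adj ((g : SL(4, F)) • u) ((g : SL(4, F)) • v) ↔
      (suzukiTitsGraph F e).Adj u v := by
  have hg : (g : SL(4, F)) • suzukiTitsOvoid F e = suzukiTitsOvoid F e :=
    MulAction.mem_stabilizer_iff.1 g.2
  simp only [suzukiTitsGraph, ← smul_sub]
  constructor
  · rintro ⟨h, hm⟩
    have h' : u - v ≠ 0 := (smul_ne_zero_iff_ne _).1 h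
    rw [← Projectivization.smul_mk _ h', ← hg, Set.smul_mem_smul_set_iff] at hm
    exact ⟨h', hm⟩
  · rintro ⟨h, hm⟩
    refine ⟨(smul_ne_zero_iff_ne _).2 h, ?_⟩
    rwa [← Projectivization.smul_mk _ h, ← hg, Set.smul_mem_smul_set_iff]

/-- The action of the Suzuki group on the Suzuki-Tits ovoid graph. -/
def suzukiGroupToAut (F : Type*) [Field F] (e : ℕ) :
    suzukiGroup F e →* (suzukiTitsGraph F e ≃g suzukiTitsGraph F e) where
  toFun g :=
    { toEquiv := MulAction.toPerm (g : SL(4, F))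
      map_rel_iff' := fun {u v} => suzukiTitsGraph_adj_smul g u v }
  map_one' := RelIso.ext fun v => one_smul SL(4, F) v
  map_mul' g h := RelIso.ext fun v => mul_smul (g : SL(4, F)) (h : SL(4, F)) v

theorem suzukiGroupToAut_injective : Function.Injective (suzukiGroupToAut F e) := fun _ _ hgh =>
  Subtype.ext (specialLinearGroup_ext_smul fun x y z t =>
    congrArg (fun φ : suzukiTitsGraph F e ≃g suzukiTitsGraph F e => φ ![x, y, z, t]) hgh)

end SuzukiTitsGraph

/-- Conjugation of graph automorphisms by an isomorphism. -/
def SimpleGraph.Iso.conj {V W : Type*} {G : SimpleGraph V} {G' : SimpleGraph W} (φ : G ≃g G') :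
    (G' ≃g G') →* (G ≃g G) where
  toFun f := (φ.trans f).trans φ.symm
  map_one' := RelIso.ext fun v => φ.symm_apply_apply v
  map_mul' f g := RelIso.ext fun v => by
    change φ.symm (f (g (φ v))) = φ.symm (f (φ (φ.symm (g (φ v)))))
    rw [φ.apply_symm_apply]

theorem SimpleGraph.Iso.conj_injective {V W : Type*} {G : SimpleGraph V} {G' : SimpleGraph W}
    (φ : G ≃g G') : Function.Injective φ.conj := fun f g h => RelIso.ext fun w => by
  have h1 : φ.symm (f (φ (φ.symm w))) = φ.symm (g (φ (φ.symm w))) :=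
    congrArg (fun k : G ≃g G => k (φ.symm w)) h
  rw [φ.apply_symm_apply] at h1
  exact φ.symm.injective h1

theorem lemma3p13 {F V : Type*} [Field F] [AddCommGroup V] [Module F V]
    (e : ℕ) (he : 1 ≤ e) (hF : Nat.card F = 2 ^ (2 * e + 1))
    (κ : QuadraticForm F V) (hκ : IsNonsingularOfMinusType κ 2) :
    (∀ H : Subgroup (affinePolarGraph κ ≃g affinePolarGraph κ),
        IsEmpty (H ≃* suzukiGroup F e)) ∧
      IsEmpty (affinePolarGraph κ ≃g suzukiTitsGraph F e) := by
  have hfin : Finite F := Nat.finite_of_card_ne_zero (by rw [hF]; positivity)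
  have hchar : CharP F 2 := by
    have := Fintype.ofFinite F
    have : Fact (Nat.Prime 2) := ⟨Nat.prime_two⟩
    exact charP_of_card_eq_prime_pow (by rw [← Nat.card_eq_fintype_card, hF])
  have key := not_injective_suzukiGroup he hF hκ.isElliptic
  refine ⟨fun H => ⟨fun f => key (H.subtype.comp f.symm.toMonoidHom) ?_⟩,
    ⟨fun φ => key (φ.conj.comp (suzukiGroupToAut F e)) ?_⟩⟩
  · exact H.subtype_injective.comp f.symm.injective
  · exact φ.conj_injective.comp suzukiGroupToAut_injective
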